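/- A one-dimensional multi-mode system consists of a finite set $M$ of modes, a slope $A(m)\in\mathbb R$, a cost per time unit $\pi_c(m)\ge 0$ and a switching cost $\pi_d(m)\ge 0$ for each mode $m$, and numbers $V_{\min}<V_{\max}$ and $V_0\in[V_{\min},V_{\max}]$. A (finite) schedule with time horizon $T$ is a finite sequence $\sigma=\langle(m_1,t_1),\dots,(m_k,t_k)\rangle$ of timed actions with $t_i>0$ and $\sum_i t_i=T$; its run is $V_0,V_1,\dots,V_k$ with $V_i=V_{i-1}+A(m_i)t_i$; it is safe if every $V_i$ lies in $[V_{\min},V_{\max}]$; its cost is $\pi(\sigma)=\sum_i(\pi_d(m_i)+\pi_c(m_i)t_i)$. It is angular if consecutive timed actions have different slopes. A timed action $(m,t)$ is a flat step if $A(m)=0$; an up step if $A(m)>0$ and it ends at $V_{\max}$; a down step if $A(m)<0$ and it ends at $V_{\min}$; a partial-up (partial-down) step if $A(m)>0$ ($A(m)<0$) and it ends strictly between $V_{\min}$ and $V_{\max}$. A leap is a pair of consecutive timed actions, the first raising the state by exactly $V_{\max}-V_{\min}$ with a mode of positive slope, the second lowering it by the same amount with a mode of negative slope. The ten head patterns are: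 (a) flat+down, (b) down, (c) partial-up+down, (d) flat+up+down, (e) up+down, (f) partial-down+up+down, (g) partial-up+up+down, (h) partial-down+down, (i) up+partial-down+down, (j) empty. The ten tail patterns are: (a) partial-up, (b) partial-up+up, (c) up+partial-down+down, (d) up+partial-down, (e) up, (f) partial-up+down, (g) partial-up+up+down, (h) partial-up+down+up, (i) up+partial-down+down+up, (j) empty. Call a pair (head pattern, tail pattern) admissible if the tail pattern is (e) or (j), or the head pattern is (b), (e) or (j); there are exactly $44$ admissible pairs. A schedule is in standard form with a pair $(h,t)$ if it is the concatenation of a head section that follows the pattern $h$ (from $V_0$), a possibly empty sequence of leaps, and a tail section that starts at $V_{\min}$ and follows the pattern $t$. Theorem. For every safe schedule $\sigma$ with time horizon $T$ there is a safe angular schedule $\sigma'$ with the same time horizon $T$, in which at most the first timed action uses a mode of slope $0$, such that $\pi(\sigma')\le\pi(\sigma)$ and one of the following holds: 1. $\sigma'$ is in standard form with one of the $44$ admissible pairs, where moreover the head and the tail pattern together have length at most five; 2. $\sigma'$ has length at most two, and $V_0=V_{\min}$ or the run of $\sigma$ does not visit $V_{\min}$; 3. the run of $\sigma$ does not visit $V_{\min}$,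 and $\sigma'$ consists of exactly three timed actions that follow the pattern up+partial-down+up. In particular, if $V_0\neq V_{\min}$ and some timed action of $\sigma$ ends at $V_{\min}$, then $\sigma'$ can be taken in standard form as in 1. -/

import Mathlib

/-- A one-dimensional multi-mode system with discrete costs over the set `M` of modes. -/
structure MultiModeSystem (M : Type*) where
  slope : M → ℝ
  /-- cost per time unit spent in a mode -/
  contCost : M → ℝ
  /-- cost of switching to a mode -/
  discCost : M → ℝ
  vMin : ℝ
  vMax : ℝ
  v0 : ℝ
  contCost_nonneg : ∀ m, 0 ≤ contCost m
  discCost_nonneg : ∀ m, 0 ≤ discCost m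
  vMin_lt_vMax : vMin < vMax
  vMin_le_v0 : vMin ≤ v0
  v0_le_vMax : v0 ≤ vMax

/-- Elementary steps from which the head and tail patterns are composed. -/
inductive Step
  | flat | up | partialUp | down | partialDown
  deriving DecidableEq

/-- The ten head patterns, (a) to (j). -/
inductive HeadPattern
  | flat_down | down | partialUp_down | flat_up_down | up_down | partialDown_up_down
  | partialUp_up_down | partialDown_down | up_partialDown_down | empty
  deriving DecidableEq

/-- The ten tail patterns, (a) to (j). -/
inductive TailPattern
  | partialUp | partialUp_up | up_partialDown_down | up_partialDown | up | partialUp_down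
  | partialUp_up_down | partialUp_down_up | up_partialDown_down_up | empty
  deriving DecidableEq

instance : Fintype HeadPattern where
  elems := {.flat_down, .down, .partialUp_down, .flat_up_down, .up_down,
    .partialDown_up_down, .partialUp_up_down, .partialDown_down, .up_partialDown_down, .empty}
  complete := by intro x; cases x <;> decide

instance : Fintype TailPattern where
  elems := {.partialUp, .partialUp_up, .up_partialDown_down, .up_partialDown, .up,
    .partialUp_down, .partialUp_up_down, .partialUp_down_up, .up_partialDown_down_up, .empty}
  complete := by intro x; cases x <;> decide

def HeadPattern.steps : HeadPattern → List Step
  | .flat_down => [.flat, .down]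
  | .down => [.down]
  | .partialUp_down => [.partialUp, .down]
  | .flat_up_down => [.flat, .up, .down]
  | .up_down => [.up, .down]
  | .partialDown_up_down => [.partialDown, .up, .down]
  | .partialUp_up_down => [.partialUp, .up, .down]
  | .partialDown_down => [.partialDown, .down]
  | .up_partialDown_down => [.up, .partialDown, .down]
  | .empty => []

def TailPattern.steps : TailPattern → List Step
  | .partialUp => [.partialUp]
  | .partialUp_up => [.partialUp, .up]
  | .up_partialDown_down => [.up, .partialDown, .down]
  | .up_partialDown => [.up, .partialDown]
  | .up => [.up]
  | .partialUp_down => [.partialUp, .down]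
  | .partialUp_up_down => [.partialUp, .up, .down]
  | .partialUp_down_up => [.partialUp, .down, .up]
  | .up_partialDown_down_up => [.up, .partialDown, .down, .up]
  | .empty => []

/-- The combinations of head and tail patterns to be considered: the tails `up` and `empty` go with
every head, the other tails only with the heads `down`, `up_down` and `empty`. -/
def patternCombinations : Finset (HeadPattern × TailPattern) :=
  Finset.univ.filter fun p =>
    (p.2 = .up ∨ p.2 = .empty) ∨ (p.1 = .down ∨ p.1 = .up_down ∨ p.1 = .empty)

namespace MultiModeSystem

variable {M : Type*} (S : MultiModeSystem M)

/-- The state after performing, from state `v`, the timed action `a = (m, t)`. -/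
def next (v : ℝ) (a : M × ℝ) : ℝ := v + S.slope a.1 * a.2

/-- The sequence of states visited by a finite sequence of timed actions started in `v`. -/
def runFrom : ℝ → List (M × ℝ) → List ℝ
  | v, [] => [v]
  | v, a :: σ => v :: runFrom (S.next v a) σ

/-- The run `⟨V₀, V₁, …, V_k⟩` of a schedule; it includes the initial state. -/
def run (σ : List (M × ℝ)) : List ℝ := S.runFrom S.v0 σ

/-- The last state of the run. -/
def endState (σ : List (M × ℝ)) : ℝ := σ.foldl S.next S.v0

/-- `σ` is a schedule (all delays are positive) with finite time horizon `T`. -/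
def IsSchedule (T : ℝ) (σ : List (M × ℝ)) : Prop :=
  (∀ a ∈ σ, 0 < a.2) ∧ (σ.map Prod.snd).sum = T

/-- `σ` is a safe schedule with finite time horizon `T`. -/
def IsSafeSchedule (T : ℝ) (σ : List (M × ℝ)) : Prop :=
  IsSchedule T σ ∧ ∀ v ∈ S.run σ, S.vMin ≤ v ∧ v ≤ S.vMax

/-- The total cost of a schedule. -/
def cost (σ : List (M × ℝ)) : ℝ :=
  (σ.map fun a => S.discCost a.1 + S.contCost a.1 * a.2).sum

/-- No two consecutive timed actions have the same slope. -/
def IsAngular (σ : List (M × ℝ)) : Prop :=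
  σ.IsChain fun a b => S.slope a.1 ≠ S.slope b.1

/-- A zero-mode can only be used by the very first timed action. -/
def ZeroModeOnlyFirst (σ : List (M × ℝ)) : Prop :=
  ∀ a ∈ σ.tail, S.slope a.1 ≠ 0

/-- The timed action `a`, started in state `v`, is a step of the given kind. A step up (down) leads
to the upper (lower) border, a partial one to a state that is not at the border. -/
def IsStep (v : ℝ) (a : M × ℝ) : Step → Prop
  | .flat => S.slope a.1 = 0
  | .up => 0 < S.slope a.1 ∧ S.next v a = S.vMax
  | .partialUp => 0 < S.slope a.1 ∧ S.vMin < S.next v a ∧ S.next v a < S.vMax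
  | .down => S.slope a.1 < 0 ∧ S.next v a = S.vMin
  | .partialDown => S.slope a.1 < 0 ∧ S.vMin < S.next v a ∧ S.next v a < S.vMax

/-- The sequence of timed actions, started in state `v`, follows the given sequence of steps. -/
def Follows : ℝ → List (M × ℝ) → List Step → Prop
  | _, [], [] => True
  | v, a :: σ, s :: p => S.IsStep v a s ∧ Follows (S.next v a) σ p
  | _, _, _ => False

/-- The pair of timed actions `a`, `b` is a (complete) leap. -/
def IsLeap (a b : M × ℝ) : Prop :=
  0 < S.slope a.1 ∧ S.slope b.1 < 0 ∧ S.slope a.1 * a.2 + S.slope b.1 * b.2 = 0 ∧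
    S.slope a.1 * a.2 = S.vMax - S.vMin

/-- The sequence of timed actions consists of leaps only, possibly of different types. -/
def IsLeapsSection (σ : List (M × ℝ)) : Prop :=
  ∃ L : List ((M × ℝ) × (M × ℝ)),
    (∀ p ∈ L, S.IsLeap p.1 p.2) ∧ σ = L.flatMap fun p => [p.1, p.2]

/-- `σ` consists of a head section with pattern `h`, a leaps section, and a tail section with pattern
`t` that starts at `vMin`. -/
def HasForm (σ : List (M × ℝ)) (h : HeadPattern) (t : TailPattern) : Prop :=
  ∃ head leaps tail : List (M × ℝ), σ = head ++ leaps ++ tail ∧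
    S.Follows S.v0 head h.steps ∧
    S.IsLeapsSection leaps ∧
    S.endState (head ++ leaps) = S.vMin ∧
    S.Follows S.vMin tail t.steps

end MultiModeSystem

/-!
Among the schedules that cost at most as much as `σ` and visit `vMin` if `σ` does, choose one of
minimal length. It is angular, since two consecutive timed actions with the same slope could be
merged into the one with the lower cost per time unit; a timed action of slope zero can be moved to
the front, so there is at most one.

Suppose that two states of its run lie strictly between the borders. Keeping the modes, the time
horizon and all other states, the durations can still be changed along a line, on which the cost is
affine. Following the line in a direction of nonincreasing cost, either a duration vanishes, which
contradicts minimality, or one more state reaches a border. An initial timed action of slope zero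
gives the same freedom as an inner state. Hence we may assume that at most one state is inner, and
none apart from the initial one if there is a timed action of slope zero. All other timed actions
go from border to border, and a permutation of the timed actions, which changes neither cost nor
duration, collects them in the leaps section.
-/

namespace MultiModeSystem

variable {M : Type*} {S : MultiModeSystem M} {T v w : ℝ} {a b : M × ℝ}
  {σ₀ σ σ' l₁ l₂ : List (M × ℝ)}

/-! ### Runs -/

lemma next_of_slope_eq_zero (h : S.slope a.1 = 0) : S.next v a = v := by
  simp [next, h]

lemma runFrom_eq_scanl : S.runFrom v σ = σ.scanl S.next v := by
  induction σ generalizing v with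
  | nil => simp [runFrom]
  | cons a σ ih => simp [runFrom, ih]

lemma left_mem_runFrom : v ∈ S.runFrom v σ := by
  cases σ <;> simp [runFrom]

lemma mem_runFrom_cons : w ∈ S.runFrom v (a :: σ) ↔ w = v ∨ w ∈ S.runFrom (S.next v a) σ := by
  simp [runFrom]

lemma mem_runFrom_append :
    w ∈ S.runFrom v (l₁ ++ l₂) ↔
      w ∈ S.runFrom v l₁ ∨ w ∈ S.runFrom (l₁.foldl S.next v) l₂ := by
  induction l₁ generalizing v with
  | nil =>
    suffices w = v → w ∈ S.runFrom v l₂ by simpa [runFrom]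
    exact fun h => h ▸ left_mem_runFrom
  | cons a l ih => simp only [List.cons_append, mem_runFrom_cons, ih, List.foldl_cons, or_assoc]

lemma foldl_next : σ.foldl S.next v = v + (σ.map fun a => S.slope a.1 * a.2).sum := by
  induction σ generalizing v with
  | nil => simp
  | cons a σ ih => simp [ih, next, add_assoc]

lemma IsSchedule.perm (h : IsSchedule T σ) (hp : σ'.Perm σ) : IsSchedule T σ' :=
  ⟨fun a ha => h.1 a (hp.mem_iff.1 ha), (hp.map _).sum_eq.trans h.2⟩

lemma cost_eq_of_perm (hp : σ'.Perm σ) : S.cost σ' = S.cost σ :=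
  (hp.map _).sum_eq

/-! ### Shortest schedules -/

variable (S T σ₀) in
/-- `σ` is a valid replacement of `σ₀`: a safe schedule that is not more expensive and that visits
the lower border if `σ₀` does. -/
def Dominates (σ : List (M × ℝ)) : Prop :=
  S.IsSafeSchedule T σ ∧ S.cost σ ≤ S.cost σ₀ ∧ (S.vMin ∈ S.run σ₀ → S.vMin ∈ S.run σ)

variable (S T σ₀) in
/-- `σ` has minimal length among the schedules that dominate `σ₀`. -/
def IsShortest (σ : List (M × ℝ)) : Prop :=
  MinimalFor (S.Dominates T σ₀) List.length σ

lemma Dominates.perm (h : S.Dominates T σ₀ σ) (hp : σ'.Perm σ)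
    (hsafe : ∀ w ∈ S.run σ', w ∈ Set.Icc S.vMin S.vMax)
    (hvisit : S.vMin ∈ S.run σ → S.vMin ∈ S.run σ') : S.Dominates T σ₀ σ' :=
  ⟨⟨h.1.1.perm hp, hsafe⟩, (cost_eq_of_perm hp).trans_le h.2.1, hvisit ∘ h.2.2⟩

lemma IsShortest.of_dominates (h : S.IsShortest T σ₀ σ) (h' : S.Dominates T σ₀ σ')
    (hlen : σ'.length = σ.length) : S.IsShortest T σ₀ σ' :=
  ⟨h', fun _ hτ _ => hlen.trans_le (h.le hτ)⟩

lemma exists_cheapest_merge (hslope : S.slope a.1 = S.slope b.1) (ha : 0 < a.2) (hb : 0 < b.2) :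
    ∃ m, S.slope m = S.slope a.1 ∧ S.discCost m + S.contCost m * (a.2 + b.2) ≤
      S.discCost a.1 + S.contCost a.1 * a.2 + (S.discCost b.1 + S.contCost b.1 * b.2) := by
  have hda := S.discCost_nonneg a.1
  have hdb := S.discCost_nonneg b.1
  rcases le_total (S.contCost a.1) (S.contCost b.1) with hc | hc
  · exact ⟨a.1, rfl, by nlinarith⟩
  · exact ⟨b.1, hslope.symm, by nlinarith⟩

lemma eq_vMin_of_next_eq_vMin (hslope : S.slope a.1 = S.slope b.1) (ha : 0 < a.2) (hb : 0 < b.2)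
    (hv : S.vMin ≤ v) (hv' : S.vMin ≤ S.next (S.next v a) b) (h : S.next v a = S.vMin) :
    v = S.vMin ∨ S.next (S.next v a) b = S.vMin := by
  simp only [next] at *
  rcases le_total 0 (S.slope a.1) with hs | hs
  · exact Or.inl (by nlinarith)
  · exact Or.inr (by nlinarith)

lemma Dominates.exists_merge (h : S.Dominates T σ₀ (l₁ ++ a :: b :: l₂))
    (hslope : S.slope a.1 = S.slope b.1) : ∃ c, S.Dominates T σ₀ (l₁ ++ c :: l₂) := by
  obtain ⟨⟨⟨hpos, hsum⟩, hsafe⟩, hcost, hvisit⟩ := h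
  have ha : 0 < a.2 := hpos a (by simp)
  have hb : 0 < b.2 := hpos b (by simp)
  obtain ⟨m, hm, hm_cost⟩ := exists_cheapest_merge hslope ha hb
  have hnext (v : ℝ) : S.next v (m, a.2 + b.2) = S.next (S.next v a) b := by
    simp only [next, hm, ← hslope]; ring
  simp only [run, mem_runFrom_append, mem_runFrom_cons] at hsafe hvisit
  refine ⟨(m, a.2 + b.2), ⟨⟨fun x hx => ?_, ?_⟩, fun w hw => ?_⟩, ?_, fun hσ₀ => ?_⟩
  · obtain hx | rfl | hx : x ∈ l₁ ∨ x = (m, a.2 + b.2) ∨ x ∈ l₂ := by simpa using hx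
    exacts [hpos x (by simp [hx]), add_pos ha hb, hpos x (by simp [hx])]
  · simpa [add_assoc] using hsum
  · simp only [run, mem_runFrom_append, mem_runFrom_cons, hnext] at hw
    exact hsafe w (by tauto)
  · refine le_trans ?_ hcost
    simp only [cost, List.map_append, List.map_cons, List.sum_append, List.sum_cons]
    linarith
  · simp only [run, mem_runFrom_append, mem_runFrom_cons, hnext]
    rcases hvisit hσ₀ with h | h | h | h
    · exact Or.inl h
    · exact Or.inr (Or.inl h)
    · have hv := (hsafe _ (Or.inr (Or.inl rfl))).1
      have hv' := (hsafe _ (Or.inr (Or.inr (Or.inr left_mem_runFrom)))).1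
      rcases eq_vMin_of_next_eq_vMin hslope ha hb hv hv' h.symm with h | h
      · exact Or.inr (Or.inl h.symm)
      · exact Or.inr (Or.inr (h ▸ left_mem_runFrom))
    · exact Or.inr (Or.inr h)

lemma IsShortest.slope_ne (h : S.IsShortest T σ₀ (l₁ ++ a :: b :: l₂)) :
    S.slope a.1 ≠ S.slope b.1 := by
  intro hslope
  obtain ⟨c, hc⟩ := h.prop.exists_merge hslope
  simpa using h.le hc

lemma IsShortest.isAngular (h : S.IsShortest T σ₀ σ) : S.IsAngular σ := by
  rw [IsAngular, List.isChain_iff_forall_rel_of_append_cons_cons]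
  rintro a b l₁ l₂ rfl
  exact h.slope_ne

lemma IsShortest.zero_mode_to_front (h : S.IsShortest T σ₀ (l₁ ++ a :: l₂))
    (ha : S.slope a.1 = 0) : S.IsShortest T σ₀ (a :: (l₁ ++ l₂)) := by
  have hrun (w : ℝ) : w ∈ S.run (a :: (l₁ ++ l₂)) ↔ w ∈ S.run (l₁ ++ a :: l₂) := by
    have h₁ : S.v0 ∈ S.runFrom S.v0 l₁ := left_mem_runFrom
    have h₂ : l₁.foldl S.next S.v0 ∈ S.runFrom _ l₂ := left_mem_runFrom
    simp only [run, mem_runFrom_append, mem_runFrom_cons, next_of_slope_eq_zero ha]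
    grind
  exact h.of_dominates (h.prop.perm List.perm_middle.symm
    (fun w hw => h.prop.1.2 w ((hrun w).1 hw)) (hrun _).2) (by simp; omega)

lemma exists_isShortest_zeroModeOnlyFirst (h : S.IsSafeSchedule T σ₀) :
    ∃ σ, S.IsShortest T σ₀ σ ∧ S.ZeroModeOnlyFirst σ := by
  obtain ⟨σ, hσ⟩ : ∃ σ, S.IsShortest T σ₀ σ :=
    exists_minimalFor_of_wellFoundedLT _ _ ⟨σ₀, h, le_rfl, id⟩
  by_cases hzero : ∃ a ∈ σ, S.slope a.1 = 0
  · obtain ⟨a, ha, ha0⟩ := hzero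
    obtain ⟨l₁, l₂, rfl⟩ := List.append_of_mem ha
    have hfront := hσ.zero_mode_to_front ha0
    refine ⟨_, hfront, fun b hb hb0 => ?_⟩
    obtain ⟨l₃, l₄, hl⟩ := List.append_of_mem hb
    rw [List.tail_cons] at hl
    rw [hl] at hfront
    have htwo : S.IsShortest T σ₀ ([] ++ b :: a :: (l₃ ++ l₄)) :=
      IsShortest.zero_mode_to_front (l₁ := a :: l₃) hfront hb0
    exact htwo.slope_ne (hb0.trans ha0.symm)
  · push Not at hzero
    exact ⟨σ, hσ, fun a ha => hzero a (List.mem_of_mem_tail ha)⟩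

end MultiModeSystem

/-! ### Changing the durations -/

lemma exists_nonneg_forall_nonneg_and_eq_zero {ι : Type*} [Finite ι] (x d : ι → ℝ)
    (hx : ∀ i, 0 ≤ x i) (hd : ∃ i, d i < 0) :
    ∃ s, 0 ≤ s ∧ (∀ i, 0 ≤ x i + s * d i) ∧ ∃ i, d i < 0 ∧ x i + s * d i = 0 := by
  obtain ⟨i, hi, hmin⟩ :=
    Set.exists_min_image {i | d i < 0} (fun i => x i / -d i) (Set.toFinite _) hd
  have hi' : d i ≠ 0 := ne_of_lt hi
  have hs : 0 ≤ x i / -d i := div_nonneg (hx i) (neg_nonneg.2 (le_of_lt hi))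
  refine ⟨x i / -d i, hs, fun j => ?_, i, hi, by field_simp; ring⟩
  rcases lt_or_ge (d j) 0 with hj | hj
  · have := (le_div_iff₀ (neg_pos.2 hj)).1 (hmin j hj)
    linarith
  · exact add_nonneg (hx j) (mul_nonneg hs hj)

lemma countP_ofFn {α : Type*} {k : ℕ} (f : Fin k → α) (P : α → Prop) [DecidablePred P] :
    (List.ofFn f).countP (fun x => P x) = Finset.card {i | P (f i)} := by
  induction k with
  | zero => simp
  | succ k ih => simp [Fin.card_filter_univ_succ', List.countP_cons, ih, add_comm]

namespace MultiModeSystem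

variable {M : Type*} {S : MultiModeSystem M} {T v w : ℝ} {a : M × ℝ}
  {σ₀ σ : List (M × ℝ)} {k : ℕ} {m : Fin k → M} {t t' : Fin k → ℝ}

/-- The schedule with modes `m i` and durations `t i`. -/
def schedule (m : Fin k → M) (t : Fin k → ℝ) : List (M × ℝ) :=
  List.ofFn fun i => (m i, t i)

variable (S m) in
/-- The change of the state during the first `n` timed actions of `schedule m t`, as a linear
function of the durations `t`. -/
noncomputable def displacement (n : Fin (k + 1)) : (Fin k → ℝ) →ₗ[ℝ] ℝ :=
  ∑ i with i.castSucc < n, S.slope (m i) • LinearMap.proj i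

variable (S m t) in
/-- The state of the run of `schedule m t` after `n` timed actions. -/
noncomputable def state (n : Fin (k + 1)) : ℝ :=
  S.v0 + S.displacement m n t

lemma displacement_apply (n : Fin (k + 1)) :
    S.displacement m n t = ∑ i with i.castSucc < n, S.slope (m i) * t i := by
  simp [displacement]

lemma exists_schedule_eq (σ : List (M × ℝ)) :
    ∃ (k : ℕ) (m : Fin k → M) (t : Fin k → ℝ), schedule m t = σ :=
  ⟨σ.length, fun i => σ[i].1, fun i => σ[i].2, by simp [schedule]⟩

lemma mem_schedule : a ∈ schedule m t ↔ ∃ i, (m i, t i) = a :=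
  List.mem_ofFn' _ _

lemma run_schedule : S.run (schedule m t) = List.ofFn (S.state m t) := by
  rw [run, runFrom_eq_scanl]
  refine List.ext_getElem (by simp [schedule]) fun n h₁ h₂ => ?_
  rw [List.getElem_scanl, foldl_next, schedule, List.map_take, List.map_ofFn,
    List.sum_take_ofFn, List.getElem_ofFn, state, displacement_apply]
  simp [Fin.lt_def]

lemma mem_run_schedule : w ∈ S.run (schedule m t) ↔ ∃ n, S.state m t n = w := by
  rw [run_schedule]
  exact List.mem_ofFn' _ _

lemma sum_schedule : ((schedule m t).map Prod.snd).sum = ∑ i, t i := by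
  simp [schedule, List.map_ofFn, List.sum_ofFn]

lemma cost_schedule :
    S.cost (schedule m t) = ∑ i, S.discCost (m i) + ∑ i, S.contCost (m i) * t i := by
  simp [cost, schedule, List.map_ofFn, List.sum_ofFn, Finset.sum_add_distrib]

variable (S m t t') in
/-- The durations `t'` can replace `t` in a safe schedule with modes `m`, at no additional cost,
without moving a state away from the border; zero durations are allowed. -/
structure IsRetiming : Prop where
  nonneg : ∀ i, 0 ≤ t' i
  sum_eq : ∑ i, t' i = ∑ i, t i
  cost_le : ∑ i, S.contCost (m i) * t' i ≤ ∑ i, S.contCost (m i) * t i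
  safe : ∀ n, S.state m t' n ∈ Set.Icc S.vMin S.vMax
  state_eq : ∀ n, S.state m t n ∉ Set.Ioo S.vMin S.vMax → S.state m t' n = S.state m t n

variable (S m t) in
/-- The state after the timed action `i` does not restrict a change of the durations: it is not at
the border, or it cannot move because `i` is an initial timed action of slope zero. -/
def IsFree (i : Fin k) : Prop :=
  S.state m t i.succ ∈ Set.Ioo S.vMin S.vMax ∨ i.val = 0 ∧ S.slope (m i) = 0

lemma exists_direction (S : MultiModeSystem M) (m : Fin k → M) (c : Fin k → ℝ) {p q : Fin k}
    (hpq : p ≠ q) :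
    ∃ d : Fin k → ℝ, d ≠ 0 ∧ ∑ i, d i = 0 ∧ ∑ i, c i * d i ≤ 0 ∧
      ∀ i, i ≠ p → i ≠ q → S.displacement m i.succ d = 0 := by
  let Φ : (Fin k → ℝ) →ₗ[ℝ] (Option ↥({p, q}ᶜ : Finset (Fin k)) → ℝ) := LinearMap.pi fun o =>
    o.elim (∑ i, LinearMap.proj i) fun i => S.displacement m i.val.succ
  have hΦ : LinearMap.ker Φ ≠ ⊥ := by
    refine LinearMap.ker_ne_bot_of_finrank_lt ?_
    have := Finset.card_add_card_compl {p, q}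
    simp only [Finset.card_pair hpq, Fintype.card_fin] at this
    simp only [Module.finrank_fintype_fun_eq_card, Fintype.card_option, Fintype.card_coe,
      Fintype.card_fin]
    omega
  obtain ⟨d, hd, hd0⟩ := (Submodule.ne_bot_iff _).1 hΦ
  have hsum : ∑ i, d i = 0 := by simpa [Φ] using congrFun hd none
  have hdisp (i : Fin k) (hp : i ≠ p) (hq : i ≠ q) : S.displacement m i.succ d = 0 :=
    congrFun hd (some ⟨i, by simp [hp, hq]⟩)
  rcases le_total (∑ i, c i * d i) 0 with hc | hc
  · exact ⟨d, hd0, hsum, hc, hdisp⟩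
  · exact ⟨-d, neg_ne_zero.2 hd0, by simp [hsum], by simpa using hc,
      fun i hp hq => by simp [hdisp i hp hq]⟩

lemma displacement_eq_zero_of_isFree {p q : Fin k} {d : Fin k → ℝ} (hp : S.IsFree m t p)
    (hq : S.IsFree m t q) (hd : ∀ i, i ≠ p → i ≠ q → S.displacement m i.succ d = 0)
    {n : Fin (k + 1)} (hn : S.state m t n ∉ Set.Ioo S.vMin S.vMax) :
    S.displacement m n d = 0 := by
  have hfree (i : Fin k) (hi : S.IsFree m t i) (hin : S.state m t i.succ ∉ Set.Ioo S.vMin S.vMax) :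
      S.displacement m i.succ d = 0 := by
    obtain ⟨hi0, hslope⟩ := hi.resolve_left hin
    rw [displacement_apply]
    refine Finset.sum_eq_zero fun j hj => ?_
    obtain rfl : j = i := by
      simp only [Finset.mem_filter_univ, Fin.castSucc_lt_succ_iff] at hj
      exact Fin.ext (by omega)
    rw [hslope, zero_mul]
  cases n using Fin.cases with
  | zero => simp [displacement_apply]
  | succ i =>
    by_cases hip : i = p
    · exact hfree i (hip ▸ hp) hn
    by_cases hiq : i = q
    · exact hfree i (hiq ▸ hq) hn
    exact hd i hip hiq

lemma state_add_smul (d : Fin k → ℝ) (s : ℝ) (n : Fin (k + 1)) :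
    S.state m (t + s • d) n = S.state m t n + s * S.displacement m n d := by
  simp only [state, map_add, map_smul, smul_eq_mul]
  ring

lemma isRetiming_add_smul {d : Fin k → ℝ} {s : ℝ} (hs : 0 ≤ s) (hsum : ∑ i, d i = 0)
    (hcost : ∑ i, S.contCost (m i) * d i ≤ 0) (hnonneg : ∀ i, 0 ≤ t i + s * d i)
    (hsafe : ∀ n, S.state m t n + s * S.displacement m n d ∈ Set.Icc S.vMin S.vMax)
    (hfix : ∀ n, S.state m t n ∉ Set.Ioo S.vMin S.vMax → S.displacement m n d = 0) :
    S.IsRetiming m t (t + s • d) where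
  nonneg := hnonneg
  sum_eq := by simp [Finset.sum_add_distrib, ← Finset.mul_sum, hsum]
  cost_le := by
    simp only [Pi.add_apply, Pi.smul_apply, smul_eq_mul, mul_add, Finset.sum_add_distrib,
      mul_left_comm _ s, ← Finset.mul_sum]
    nlinarith
  safe n := by simpa only [state_add_smul] using hsafe n
  state_eq n hn := by rw [state_add_smul, hfix n hn, mul_zero, add_zero]

lemma exists_retiming (ht : ∀ i, 0 ≤ t i) (hsafe : ∀ n, S.state m t n ∈ Set.Icc S.vMin S.vMax)
    {p q : Fin k} (hpq : p ≠ q) (hp : S.IsFree m t p) (hq : S.IsFree m t q) :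
    ∃ t', S.IsRetiming m t t' ∧ ((∃ i, t' i = 0) ∨ ∃ n,
      S.state m t n ∈ Set.Ioo S.vMin S.vMax ∧ S.state m t' n ∉ Set.Ioo S.vMin S.vMax) := by
  obtain ⟨d, hd0, hdsum, hdcost, hd⟩ := exists_direction S m (fun i => S.contCost (m i)) hpq
  have hfix (n) (hn : S.state m t n ∉ Set.Ioo S.vMin S.vMax) : S.displacement m n d = 0 :=
    displacement_eq_zero_of_isFree hp hq hd hn
  obtain ⟨i₀, hi₀⟩ : ∃ i, d i < 0 := by
    by_contra! h
    exact hd0 (funext fun i =>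
      (Finset.sum_eq_zero_iff_of_nonneg fun i _ => h i).1 hdsum i (Finset.mem_univ i))
  -- the constraints on `t + s • d`: nonnegative durations, and the two safety bounds
  obtain ⟨s, hs, hcons, c, hc, hc0⟩ := exists_nonneg_forall_nonneg_and_eq_zero
    (ι := Fin k ⊕ (Fin (k + 1) ⊕ Fin (k + 1)))
    (Sum.elim t (Sum.elim (fun n => S.state m t n - S.vMin) fun n => S.vMax - S.state m t n))
    (Sum.elim d (Sum.elim (fun n => S.displacement m n d) fun n => -S.displacement m n d))
    (by rintro (i | n | n)
        exacts [ht i, sub_nonneg.2 (hsafe n).1, sub_nonneg.2 (hsafe n).2])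
    ⟨Sum.inl i₀, hi₀⟩
  simp only [Sum.forall, Sum.elim_inl, Sum.elim_inr] at hcons
  obtain ⟨hnonneg, hmin, hmax⟩ := hcons
  refine ⟨t + s • d, isRetiming_add_smul hs hdsum hdcost hnonneg
    (fun n => ⟨by linarith [hmin n], by linarith [hmax n]⟩) hfix, ?_⟩
  rcases c with i | n | n
  · exact Or.inl ⟨i, hc0⟩
  all_goals
    simp only [Sum.elim_inr, Sum.elim_inl] at hc hc0
    refine Or.inr ⟨n, not_not.1 fun hn => ?_, fun hn => ?_⟩
    · simp [hfix n hn] at hc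
    · rw [state_add_smul] at hn
      linarith [hn.1, hn.2]

lemma mem_runFrom_filter (h : ∀ a ∈ σ, 0 ≤ a.2) :
    w ∈ S.runFrom v (σ.filter fun a => 0 < a.2) ↔ w ∈ S.runFrom v σ := by
  induction σ generalizing v with
  | nil => simp
  | cons a σ ih =>
    obtain ⟨ha, hσ⟩ := List.forall_mem_cons.1 h
    rcases ha.eq_or_lt with ha | ha
    · have hv : v ∈ S.runFrom v σ := left_mem_runFrom
      rw [List.filter_cons_of_neg (by simp [← ha]), ih hσ, mem_runFrom_cons,
        show S.next v a = v by simp [next, ← ha]]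
      grind
    · rw [List.filter_cons_of_pos (by simpa using ha), mem_runFrom_cons, mem_runFrom_cons, ih hσ]

lemma sum_filter (h : ∀ a ∈ σ, 0 ≤ a.2) :
    ((σ.filter fun a => 0 < a.2).map Prod.snd).sum = (σ.map Prod.snd).sum := by
  induction σ with
  | nil => simp
  | cons a σ ih =>
    obtain ⟨ha, hσ⟩ := List.forall_mem_cons.1 h
    rcases ha.eq_or_lt with ha | ha
    · rw [List.filter_cons_of_neg (by simp [← ha]), ih hσ, List.map_cons, List.sum_cons, ← ha,
        zero_add]
    · rw [List.filter_cons_of_pos (by simpa using ha), List.map_cons, List.map_cons,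
        List.sum_cons, List.sum_cons, ih hσ]

lemma cost_filter_le (h : ∀ a ∈ σ, 0 ≤ a.2) :
    S.cost (σ.filter fun a => 0 < a.2) ≤ S.cost σ := by
  refine List.Sublist.sum_le_sum (List.filter_sublist.map _) fun x hx => ?_
  obtain ⟨a, ha, rfl⟩ := List.mem_map.1 hx
  exact add_nonneg (S.discCost_nonneg _) (mul_nonneg (S.contCost_nonneg _) (h a ha))

lemma IsRetiming.dominates_filter (h : S.IsRetiming m t t')
    (hdom : S.Dominates T σ₀ (schedule m t)) :
    S.Dominates T σ₀ ((schedule m t').filter fun a => 0 < a.2) := by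
  obtain ⟨⟨⟨-, hsum⟩, -⟩, hcost, hvisit⟩ := hdom
  have hnonneg : ∀ a ∈ schedule m t', 0 ≤ a.2 := by
    intro a ha
    obtain ⟨i, rfl⟩ := mem_schedule.1 ha
    exact h.nonneg i
  refine ⟨⟨⟨fun a ha => of_decide_eq_true (List.mem_filter.1 ha).2, ?_⟩, fun w hw => ?_⟩, ?_,
    fun hσ₀ => ?_⟩
  · rw [sum_filter hnonneg, sum_schedule, h.sum_eq, ← hsum, sum_schedule]
  · rw [run, mem_runFrom_filter hnonneg] at hw
    obtain ⟨n, rfl⟩ := mem_run_schedule.1 hw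
    exact h.safe n
  · have := h.cost_le
    refine (cost_filter_le hnonneg).trans (le_trans ?_ hcost)
    rw [cost_schedule, cost_schedule]
    linarith
  · rw [run, mem_runFrom_filter hnonneg]
    obtain ⟨n, hn⟩ := mem_run_schedule.1 (hvisit hσ₀)
    refine mem_run_schedule.2 ⟨n, ?_⟩
    rw [h.state_eq n (by simp [hn]), hn]

lemma IsRetiming.filter_eq_self (h : S.IsRetiming m t t')
    (hshort : S.IsShortest T σ₀ (schedule m t)) :
    (schedule m t').filter (fun a => 0 < a.2) = schedule m t' := by
  refine List.filter_sublist.eq_of_length_le ?_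
  calc (schedule m t').length = (schedule m t).length := by simp [schedule]
    _ ≤ _ := hshort.le (h.dominates_filter hshort.prop)

/-! ### Schedules with at most one state away from the border -/

open Classical in
variable (S) in
/-- The number of timed actions of `σ`, started in state `v`, that do not end at the border. -/
noncomputable def innerCount (v : ℝ) (σ : List (M × ℝ)) : ℕ :=
  (S.runFrom v σ).tail.countP (· ∈ Set.Ioo S.vMin S.vMax)

open Classical in
lemma innerCount_cons :
    S.innerCount v (a :: σ) =
      (if S.next v a ∈ Set.Ioo S.vMin S.vMax then 1 else 0) + S.innerCount (S.next v a) σ := by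
  cases σ <;> simp [innerCount, runFrom, List.countP_cons, add_comm]

open Classical in
lemma innerCount_schedule :
    S.innerCount S.v0 (schedule m t) =
      Finset.card {i : Fin k | S.state m t i.succ ∈ Set.Ioo S.vMin S.vMax} := by
  rw [innerCount, ← run, run_schedule, List.ofFn_succ, List.tail_cons]
  exact countP_ofFn _ _

lemma IsRetiming.innerCount_lt (h : S.IsRetiming m t t') {n : Fin (k + 1)}
    (hn : S.state m t n ∈ Set.Ioo S.vMin S.vMax) (hn' : S.state m t' n ∉ Set.Ioo S.vMin S.vMax) :
    S.innerCount S.v0 (schedule m t') < S.innerCount S.v0 (schedule m t) := by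
  obtain rfl | ⟨i, rfl⟩ := n.eq_zero_or_eq_succ
  · simp only [state, displacement_apply] at hn hn'
    simp_all
  rw [innerCount_schedule, innerCount_schedule]
  refine Finset.card_lt_card (Finset.ssubset_iff_of_subset (fun j hj => ?_) |>.2
    ⟨i, by simpa using hn, by simpa using hn'⟩)
  simp only [Finset.mem_filter_univ] at hj ⊢
  by_contra hj'
  exact hj' (h.state_eq _ hj' ▸ hj)

variable (S T σ₀) in
/-- `σ` has the least number of states away from the border among the shortest schedules that
dominate `σ₀` and use a mode of slope zero at most at the beginning. -/
def IsReduced (σ : List (M × ℝ)) : Prop :=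
  MinimalFor (fun σ => S.IsShortest T σ₀ σ ∧ S.ZeroModeOnlyFirst σ) (S.innerCount S.v0) σ

lemma exists_isReduced (h : S.IsSafeSchedule T σ₀) : ∃ σ, S.IsReduced T σ₀ σ :=
  exists_minimalFor_of_wellFoundedLT _ _ (exists_isShortest_zeroModeOnlyFirst h)

lemma zeroModeOnlyFirst_schedule_congr (h : S.ZeroModeOnlyFirst (schedule m t)) :
    S.ZeroModeOnlyFirst (schedule m t') := by
  cases k with
  | zero => simp [ZeroModeOnlyFirst, schedule]
  | succ k => simpa [ZeroModeOnlyFirst, schedule] using h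

lemma IsReduced.isFree_unique (h : S.IsReduced T σ₀ (schedule m t)) {p q : Fin k}
    (hp : S.IsFree m t p) (hq : S.IsFree m t q) : p = q := by
  by_contra hpq
  have hshort := h.prop.1
  have ht : ∀ i, 0 ≤ t i := fun i => (hshort.prop.1.1.1 _ (mem_schedule.2 ⟨i, rfl⟩)).le
  have hsafe : ∀ n, S.state m t n ∈ Set.Icc S.vMin S.vMax :=
    fun n => hshort.prop.1.2 _ (mem_run_schedule.2 ⟨n, rfl⟩)
  obtain ⟨t', ht', hzero | ⟨n, hn, hn'⟩⟩ := exists_retiming ht hsafe hpq hp hq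
  all_goals
    have hdom := ht'.dominates_filter hshort.prop
    rw [ht'.filter_eq_self hshort] at hdom
  · obtain ⟨i, hi⟩ := hzero
    exact (hdom.1.1.1 _ (mem_schedule.2 ⟨i, rfl⟩)).ne' hi
  · have hshort' := hshort.of_dominates hdom (by simp [schedule])
    exact (ht'.innerCount_lt hn hn').not_ge
      (h.le ⟨hshort', zeroModeOnlyFirst_schedule_congr h.prop.2⟩)

lemma IsReduced.innerCount_le_one (h : S.IsReduced T σ₀ σ) : S.innerCount S.v0 σ ≤ 1 := by
  obtain ⟨k, m, t, rfl⟩ := exists_schedule_eq σ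
  rw [innerCount_schedule, Finset.card_le_one]
  intro p hp q hq
  exact h.isFree_unique (Or.inl (by simpa using hp)) (Or.inl (by simpa using hq))

lemma cons_schedule : a :: schedule m t = schedule (Fin.cons a.1 m) (Fin.cons a.2 t) := by
  simp [schedule]

lemma state_cons_of_slope_eq_zero (ha : S.slope a.1 = 0) (n : Fin (k + 1)) :
    S.state (Fin.cons a.1 m : Fin (k + 1) → M) (Fin.cons a.2 t) n.succ = S.state m t n := by
  simp [state, displacement_apply, Finset.sum_filter, Fin.sum_univ_succ, ha,
    Fin.castSucc_lt_iff_succ_le]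

lemma IsReduced.innerCount_tail_eq_zero (h : S.IsReduced T σ₀ (a :: σ)) (ha : S.slope a.1 = 0) :
    S.innerCount S.v0 σ = 0 := by
  obtain ⟨k, m, t, rfl⟩ := exists_schedule_eq σ
  rw [cons_schedule] at h
  rw [innerCount_schedule, Finset.card_eq_zero, Finset.filter_eq_empty_iff]
  intro i _ hi
  rw [← state_cons_of_slope_eq_zero ha] at hi
  exact Fin.succ_ne_zero i (h.isFree_unique (Or.inl hi) (Or.inr ⟨rfl, ha⟩))

end MultiModeSystem

/-! ### Leaps and patterns -/

namespace MultiModeSystem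

variable {M : Type*} {S : MultiModeSystem M} {T v w : ℝ} {a b : M × ℝ}
  {σ₀ σ σ' l₁ l₂ : List (M × ℝ)} {p p₁ p₂ : List Step} {h : HeadPattern} {t : TailPattern}

lemma isLeapsSection_nil : S.IsLeapsSection [] :=
  ⟨[], by simp, rfl⟩

lemma IsLeapsSection.leap_cons (ha : S.IsStep S.vMin a .up) (hb : S.IsStep S.vMax b .down)
    (hσ : S.IsLeapsSection σ) : S.IsLeapsSection (a :: b :: σ) := by
  obtain ⟨L, hL, rfl⟩ := hσ
  refine ⟨(a, b) :: L, List.forall_mem_cons.2 ⟨?_, hL⟩, by simp⟩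
  obtain ⟨ha, ha'⟩ := ha
  obtain ⟨hb, hb'⟩ := hb
  simp only [next] at ha' hb'
  exact ⟨ha, hb, by linarith, by linarith⟩

lemma IsLeapsSection.foldl_next (hσ : S.IsLeapsSection σ) : σ.foldl S.next v = v := by
  obtain ⟨L, hL, rfl⟩ := hσ
  induction L with
  | nil => rfl
  | cons q L ih =>
    obtain ⟨⟨-, -, hq, -⟩, hL⟩ := List.forall_mem_cons.1 hL
    have hv : S.next (S.next v q.1) q.2 = v := by simp only [next]; linarith
    simpa [hv] using ih hL

lemma IsLeapsSection.safe (hσ : S.IsLeapsSection σ) :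
    ∀ w ∈ S.runFrom S.vMin σ, w ∈ Set.Icc S.vMin S.vMax := by
  have hlt := S.vMin_lt_vMax
  obtain ⟨L, hL, rfl⟩ := hσ
  induction L with
  | nil => simpa [runFrom] using hlt.le
  | cons q L ih =>
    obtain ⟨⟨-, -, hq, hq'⟩, hL⟩ := List.forall_mem_cons.1 hL
    have hup : S.next S.vMin q.1 = S.vMax := by simp only [next]; linarith
    have hdown : S.next S.vMax q.2 = S.vMin := by simp only [next]; linarith
    simp only [List.flatMap_cons, List.cons_append, List.nil_append, mem_runFrom_cons, hup, hdown]
    rintro w (rfl | rfl | hw)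
    exacts [⟨le_rfl, hlt.le⟩, ⟨hlt.le, le_rfl⟩, ih hL w hw]

lemma IsLeapsSection.slope_ne_zero (hσ : S.IsLeapsSection σ) : ∀ a ∈ σ, S.slope a.1 ≠ 0 := by
  obtain ⟨L, hL, rfl⟩ := hσ
  simp only [List.mem_flatMap, List.mem_cons, List.not_mem_nil, or_false]
  rintro a ⟨q, hq, rfl | rfl⟩
  exacts [(hL q hq).1.ne', (hL q hq).2.1.ne]

lemma follows_nil_right : S.Follows v σ [] ↔ σ = [] := by
  cases σ <;> simp [Follows]

lemma follows_cons_right {s : Step} :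
    S.Follows v σ (s :: p) ↔
      ∃ a τ, σ = a :: τ ∧ S.IsStep v a s ∧ S.Follows (S.next v a) τ p := by
  cases σ <;> simp [Follows]

lemma Follows.nil : S.Follows v [] [] :=
  trivial

lemma Follows.up (ha : S.IsStep v a .up) (hσ : S.Follows S.vMax σ p) :
    S.Follows v (a :: σ) (.up :: p) :=
  ⟨ha, ha.2.symm ▸ hσ⟩

lemma Follows.down (ha : S.IsStep v a .down) (hσ : S.Follows S.vMin σ p) :
    S.Follows v (a :: σ) (.down :: p) :=
  ⟨ha, ha.2.symm ▸ hσ⟩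

lemma Follows.append (h₁ : S.Follows v l₁ p₁) (h₂ : S.Follows (l₁.foldl S.next v) l₂ p₂) :
    S.Follows v (l₁ ++ l₂) (p₁ ++ p₂) := by
  induction p₁ generalizing v l₁ with
  | nil =>
    obtain rfl := follows_nil_right.1 h₁
    exact h₂
  | cons s p₁ ih =>
    obtain ⟨a, l₁, rfl, ha, h₁⟩ := follows_cons_right.1 h₁
    exact ⟨ha, ih h₁ h₂⟩

lemma Follows.length_eq (hσ : S.Follows v σ p) : σ.length = p.length := by
  induction p generalizing v σ with
  | nil => simp [follows_nil_right.1 hσ]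
  | cons s p ih =>
    obtain ⟨a, σ, rfl, -, hσ⟩ := follows_cons_right.1 hσ
    simp [ih hσ]

lemma Follows.foldl_next_eq_vMin (hσ : S.Follows v σ p) (hp : p.getLast? = some .down) :
    σ.foldl S.next v = S.vMin := by
  induction p generalizing v σ with
  | nil => simp at hp
  | cons s p ih =>
    obtain ⟨a, σ, rfl, ha, hσ⟩ := follows_cons_right.1 hσ
    cases p with
    | nil =>
      obtain rfl := follows_nil_right.1 hσ
      obtain rfl : s = .down := by simpa using hp
      exact ha.2
    | cons r p =>
      rw [List.foldl_cons]
      exact ih hσ (by simpa using hp)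

lemma IsStep.next_mem_Icc {s : Step} (ha : S.IsStep v a s) (hv : v ∈ Set.Icc S.vMin S.vMax) :
    S.next v a ∈ Set.Icc S.vMin S.vMax := by
  have hlt := S.vMin_lt_vMax.le
  cases s with
  | flat => rwa [next_of_slope_eq_zero ha]
  | up => exact ha.2.symm ▸ Set.right_mem_Icc.2 hlt
  | down => exact ha.2.symm ▸ Set.left_mem_Icc.2 hlt
  | partialUp => exact Set.Ioo_subset_Icc_self ha.2
  | partialDown => exact Set.Ioo_subset_Icc_self ha.2

lemma Follows.safe (hσ : S.Follows v σ p) (hv : v ∈ Set.Icc S.vMin S.vMax) :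
    ∀ w ∈ S.runFrom v σ, w ∈ Set.Icc S.vMin S.vMax := by
  induction p generalizing v σ with
  | nil =>
    obtain rfl := follows_nil_right.1 hσ
    simpa [runFrom] using hv
  | cons s p ih =>
    obtain ⟨a, σ, rfl, ha, hσ⟩ := follows_cons_right.1 hσ
    simp only [mem_runFrom_cons]
    rintro w (rfl | hw)
    exacts [hv, ih hσ (ha.next_mem_Icc hv) w hw]

lemma Follows.vMin_notMem_runFrom (hσ : S.Follows v σ p) (hp : .down ∉ p) (hv : S.vMin < v) :
    S.vMin ∉ S.runFrom v σ := by
  induction p generalizing v σ with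
  | nil =>
    obtain rfl := follows_nil_right.1 hσ
    simpa [runFrom] using hv.ne
  | cons s p ih =>
    obtain ⟨a, σ, rfl, ha, hσ⟩ := follows_cons_right.1 hσ
    have hlt := S.vMin_lt_vMax
    have hnext : S.vMin < S.next v a := by
      cases s with
      | flat => rwa [next_of_slope_eq_zero ha]
      | up => rwa [ha.2]
      | down => simp at hp
      | partialUp => exact ha.2.1
      | partialDown => exact ha.2.1
    rw [mem_runFrom_cons, not_or]
    exact ⟨hv.ne, ih hσ (List.not_mem_of_not_mem_cons hp) hnext⟩

lemma IsStep.slope_ne_zero {s : Step} (ha : S.IsStep v a s) (hs : s ≠ .flat) :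
    S.slope a.1 ≠ 0 := by
  cases s with
  | flat => exact absurd rfl hs
  | up => exact ha.1.ne'
  | down => exact ha.1.ne
  | partialUp => exact ha.1.ne'
  | partialDown => exact ha.1.ne

lemma Follows.slope_ne_zero (hσ : S.Follows v σ p) (hp : .flat ∉ p) :
    ∀ a ∈ σ, S.slope a.1 ≠ 0 := by
  induction p generalizing v σ with
  | nil => simp [follows_nil_right.1 hσ]
  | cons s p ih =>
    obtain ⟨a, σ, rfl, ha, hσ⟩ := follows_cons_right.1 hσ
    rw [List.mem_cons, not_or] at hp
    exact List.forall_mem_cons.2 ⟨ha.slope_ne_zero (Ne.symm hp.1), ih hσ hp.2⟩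

lemma hasForm_of_follows {head leaps tail : List (M × ℝ)} (hh : S.Follows S.v0 head h.steps)
    (hv : h = .empty → S.v0 = S.vMin) (hl : S.IsLeapsSection leaps)
    (ht : S.Follows S.vMin tail t.steps) : S.HasForm (head ++ leaps ++ tail) h t := by
  refine ⟨head, leaps, tail, rfl, hh, hl, ?_, ht⟩
  rw [endState, List.foldl_append, hl.foldl_next]
  cases h with
  | empty =>
    obtain rfl := follows_nil_right.1 hh
    exact hv rfl
  | _ => exact hh.foldl_next_eq_vMin rfl

lemma HasForm.safe (hσ : S.HasForm σ h t) : ∀ w ∈ S.run σ, w ∈ Set.Icc S.vMin S.vMax := by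
  obtain ⟨head, leaps, tail, rfl, hh, hl, hend, ht⟩ := hσ
  have hhead : head.foldl S.next S.v0 = S.vMin := by
    rw [← hend, endState, List.foldl_append, hl.foldl_next]
  rw [endState] at hend
  simp only [run, mem_runFrom_append, hend, hhead]
  rintro w ((hw | hw) | hw)
  · exact hh.safe ⟨S.vMin_le_v0, S.v0_le_vMax⟩ w hw
  · exact hl.safe w hw
  · exact ht.safe ⟨le_rfl, S.vMin_lt_vMax.le⟩ w hw

lemma HasForm.vMin_mem_run (hσ : S.HasForm σ h t) : S.vMin ∈ S.run σ := by
  obtain ⟨head, leaps, tail, rfl, -, -, hend, -⟩ := hσ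
  rw [run, mem_runFrom_append, ← endState, hend]
  exact Or.inr left_mem_runFrom

lemma HasForm.zeroModeOnlyFirst (hσ : S.HasForm σ h t) : S.ZeroModeOnlyFirst σ := by
  obtain ⟨head, leaps, tail, rfl, hh, hl, -, ht⟩ := hσ
  have htail : ∀ a ∈ leaps ++ tail, S.slope a.1 ≠ 0 :=
    List.forall_mem_append.2 ⟨hl.slope_ne_zero, ht.slope_ne_zero (by cases t <;> decide)⟩
  rw [List.append_assoc]
  cases head with
  | nil => exact fun a ha => htail a (List.mem_of_mem_tail ha)
  | cons a head =>
    cases hp : h.steps with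
    | nil => simp [hp, Follows] at hh
    | cons s p =>
      rw [hp] at hh
      have hflat : .flat ∉ p := by cases h <;> cases hp <;> decide
      exact List.forall_mem_append.2 ⟨hh.2.slope_ne_zero hflat, htail⟩

lemma HasForm.isShortest_of_perm (hσ' : S.HasForm σ' h t) (hσ : S.IsShortest T σ₀ σ)
    (hp : σ'.Perm σ) : S.IsShortest T σ₀ σ' :=
  hσ.of_dominates (hσ.prop.perm hp hσ'.safe fun _ => hσ'.vMin_mem_run) hp.length_eq

end MultiModeSystem

/-! ### Classification of the reduced schedules -/

namespace MultiModeSystem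

variable {M : Type*} {S : MultiModeSystem M} {T v : ℝ} {n : ℕ} {a b c d : M × ℝ}
  {σ₀ σ ρ ρ' pre head : List (M × ℝ)} {p : List Step} {h : HeadPattern} {t t' : TailPattern}

/-- Started in state `v`, the sequence `σ` consists of steps up, steps down and exactly `n` partial
steps, each of which moves the state in its direction. -/
inductive StepPath (S : MultiModeSystem M) : ℕ → ℝ → List (M × ℝ) → Prop
  | nil {v : ℝ} : StepPath S 0 v []
  | up {n : ℕ} {v : ℝ} {a : M × ℝ} {σ : List (M × ℝ)} (hv : v < S.vMax)
      (ha : S.IsStep v a .up) (hσ : StepPath S n S.vMax σ) : StepPath S n v (a :: σ)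
  | down {n : ℕ} {v : ℝ} {a : M × ℝ} {σ : List (M × ℝ)} (hv : S.vMin < v)
      (ha : S.IsStep v a .down) (hσ : StepPath S n S.vMin σ) : StepPath S n v (a :: σ)
  | partialUp {n : ℕ} {v : ℝ} {a : M × ℝ} {σ : List (M × ℝ)} (hv : v < S.next v a)
      (ha : S.IsStep v a .partialUp) (hσ : StepPath S n (S.next v a) σ) :
      StepPath S (n + 1) v (a :: σ)
  | partialDown {n : ℕ} {v : ℝ} {a : M × ℝ} {σ : List (M × ℝ)} (hv : S.next v a < v)
      (ha : S.IsStep v a .partialDown) (hσ : StepPath S n (S.next v a) σ) :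
      StepPath S (n + 1) v (a :: σ)

lemma stepPath_innerCount (hsafe : ∀ w ∈ S.runFrom v σ, w ∈ Set.Icc S.vMin S.vMax)
    (hpos : ∀ a ∈ σ, 0 < a.2) (hslope : ∀ a ∈ σ, S.slope a.1 ≠ 0) :
    S.StepPath (S.innerCount v σ) v σ := by
  induction σ generalizing v with
  | nil => exact .nil
  | cons a σ ih =>
    simp only [mem_runFrom_cons, forall_eq_or_imp, List.forall_mem_cons] at hsafe hpos hslope
    obtain ⟨hv, hsafe⟩ := hsafe
    obtain ⟨ha, hpos⟩ := hpos
    obtain ⟨ha0, hslope⟩ := hslope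
    have hnext := hsafe _ left_mem_runFrom
    have hdir : S.next v a = v + S.slope a.1 * a.2 := rfl
    specialize ih hsafe hpos hslope
    rw [innerCount_cons]
    split_ifs with hin
    · rw [add_comm]
      rcases ha0.lt_or_gt with hs | hs
      · exact .partialDown (by linarith [mul_neg_of_neg_of_pos hs ha]) ⟨hs, hin⟩ ih
      · exact .partialUp (by linarith [mul_pos hs ha]) ⟨hs, hin⟩ ih
    · rw [zero_add]
      rw [Set.mem_Ioo, not_and_or, not_lt, not_lt] at hin
      rcases ha0.lt_or_gt with hs | hs
      · have hlt : S.next v a < v := by linarith [mul_neg_of_neg_of_pos hs ha]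
        have hmin : S.next v a = S.vMin :=
          hin.elim hnext.1.antisymm' fun h => absurd (h.trans_lt hlt) hv.2.not_gt
        exact .down (hmin ▸ hlt) ⟨hs, hmin⟩ (hmin ▸ ih)
      · have hlt : v < S.next v a := by linarith [mul_pos hs ha]
        have hmax : S.next v a = S.vMax :=
          hin.elim (fun h => absurd (hlt.trans_le h) hv.1.not_gt) hnext.2.antisymm
        exact .up (hmax ▸ hlt) ⟨hs, hmax⟩ (hmax ▸ ih)

variable (S) in
/-- The sequence `ρ` is a rearrangement of a leaps section followed by a tail section with
pattern `t`. -/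
def HasTailForm (ρ : List (M × ℝ)) (t : TailPattern) : Prop :=
  ∃ leaps tail, S.IsLeapsSection leaps ∧ S.Follows S.vMin tail t.steps ∧ (leaps ++ tail).Perm ρ

lemma Follows.hasTailForm (hρ : S.Follows S.vMin ρ t.steps) : S.HasTailForm ρ t :=
  ⟨[], ρ, isLeapsSection_nil, hρ, .refl ρ⟩

lemma HasTailForm.perm (hρ : S.HasTailForm ρ t) (hp : ρ.Perm ρ') : S.HasTailForm ρ' t := by
  obtain ⟨leaps, tail, hl, ht, hρ⟩ := hρ
  exact ⟨leaps, tail, hl, ht, hρ.trans hp⟩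

lemma HasTailForm.leap_cons (hρ : S.HasTailForm ρ t) (ha : S.IsStep S.vMin a .up)
    (hb : S.IsStep S.vMax b .down) : S.HasTailForm (a :: b :: ρ) t := by
  obtain ⟨leaps, tail, hl, ht, hρ⟩ := hρ
  exact ⟨a :: b :: leaps, tail, hl.leap_cons ha hb, ht, (hρ.cons b).cons a⟩

lemma HasTailForm.append_left (hρ : S.HasTailForm ρ t) (hpre : S.Follows S.vMin pre p)
    (hp : p.getLast? = some .down) (ht' : t'.steps = p ++ t.steps) :
    S.HasTailForm (pre ++ ρ) t' := by
  obtain ⟨leaps, tail, hl, ht, hρ⟩ := hρ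
  refine ⟨leaps, pre ++ tail, hl, ht' ▸ hpre.append ?_, ?_⟩
  · rwa [hpre.foldl_next_eq_vMin hp]
  · exact (List.perm_append_comm_assoc ..).trans (hρ.append_left pre)

lemma HasTailForm.exists_up_cons (hρ : S.HasTailForm ρ .up) :
    ∃ a ρ', S.IsStep S.vMin a .up ∧ S.HasTailForm ρ' .empty ∧ (a :: ρ').Perm ρ := by
  obtain ⟨leaps, tail, hl, ht, hρ⟩ := hρ
  obtain ⟨a, tail, rfl, ha, ht⟩ := follows_cons_right.1 ht
  obtain rfl := follows_nil_right.1 ht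
  exact ⟨a, leaps, ha, ⟨leaps, [], hl, .nil, by simp⟩,
    (List.perm_append_singleton a leaps).symm.trans hρ⟩

lemma HasTailForm.append_right (hρ : S.HasTailForm ρ .empty)
    (hσ : S.Follows S.vMin σ t.steps) : S.HasTailForm (ρ ++ σ) t := by
  obtain ⟨leaps, tail, hl, ht, hρ⟩ := hρ
  obtain rfl := follows_nil_right.1 ht
  rw [List.append_nil] at hρ
  exact ⟨leaps, σ, hl, hσ, hρ.append_right σ⟩

lemma StepPath.hasTailForm_zero (hρ : S.StepPath 0 S.vMin ρ) :
    S.HasTailForm ρ .empty ∨ S.HasTailForm ρ .up := by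
  induction hk : ρ.length using Nat.strong_induction_on generalizing ρ with | _ k ih
  cases hρ with
  | nil => exact .inl (Follows.hasTailForm .nil)
  | down hv => exact absurd hv (lt_irrefl _)
  | up hv ha hρ =>
    cases hρ with
    | nil => exact .inr (Follows.hasTailForm (.up ha .nil))
    | up hv => exact absurd hv (lt_irrefl _)
    | down hv hb hρ =>
      exact (ih _ (by simp [← hk]) hρ rfl).imp (·.leap_cons ha hb) (·.leap_cons ha hb)

lemma follows_partialUp_down (ha : S.IsStep S.vMax a .partialDown)
    (hb : S.IsStep (S.next S.vMax a) b .up) :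
    S.Follows S.vMin [b, a] [.partialUp, .down] := by
  obtain ⟨ha, ha₁, ha₂⟩ := ha
  obtain ⟨hb, hb'⟩ := hb
  simp only [next] at ha₁ ha₂ hb'
  refine ⟨⟨hb, ?_, ?_⟩, ⟨ha, ?_⟩, trivial⟩ <;> simp only [next] <;> linarith

lemma StepPath.exists_hasTailForm_partialUp_down (hρ : S.StepPath 0 S.vMin ρ)
    (hpre : S.Follows S.vMin pre [.partialUp, .down]) : ∃ t, S.HasTailForm (pre ++ ρ) t := by
  rcases hρ.hasTailForm_zero with h | h
  · exact ⟨.partialUp_down, h.append_left hpre rfl rfl⟩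
  · exact ⟨.partialUp_down_up, h.append_left hpre rfl rfl⟩

lemma StepPath.exists_hasTailForm_of_partialUp
    (ha : S.IsStep S.vMin a .partialUp) (hρ : S.StepPath 0 (S.next S.vMin a) ρ) :
    ∃ t, S.HasTailForm (a :: ρ) t := by
  cases hρ with
  | nil => exact ⟨.partialUp, Follows.hasTailForm ⟨ha, .nil⟩⟩
  | @down _ _ b ρ hv hb hρ =>
    exact hρ.exists_hasTailForm_partialUp_down (pre := [a, b]) ⟨ha, .down hb .nil⟩
  | @up _ _ b ρ hv hb hρ =>
    cases hρ with
    | nil => exact ⟨.partialUp_up, Follows.hasTailForm ⟨ha, .up hb .nil⟩⟩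
    | up hv => exact absurd hv (lt_irrefl _)
    | @down _ _ c ρ hv hc hρ =>
      rcases hρ.hasTailForm_zero with h | h
      · have hpre : S.Follows S.vMin [a, b, c] [.partialUp, .up, .down] :=
          ⟨ha, .up hb (.down hc .nil)⟩
        exact ⟨.partialUp_up_down, h.append_left hpre rfl rfl⟩
      · obtain ⟨u, ρ', hu, hρ', hperm⟩ := h.exists_up_cons
        have htail : S.Follows S.vMin [a, b] [.partialUp, .up] := ⟨ha, .up hb .nil⟩
        refine ⟨.partialUp_up, ((hρ'.append_right htail).leap_cons hu hc).perm ?_⟩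
        exact (List.perm_append_comm (l₁ := u :: c :: ρ') (l₂ := [a, b])).trans
          (((List.Perm.swap c u ρ').trans (hperm.cons c)).append_left [a, b])

lemma StepPath.exists_hasTailForm_of_up_partialDown (hb : S.IsStep S.vMin b .up)
    (ha : S.IsStep S.vMax a .partialDown) (hρ : S.StepPath 0 (S.next S.vMax a) ρ) :
    ∃ t, S.HasTailForm (b :: a :: ρ) t := by
  cases hρ with
  | nil => exact ⟨.up_partialDown, Follows.hasTailForm (.up hb ⟨ha, .nil⟩)⟩
  | @down _ _ c ρ hv hc hρ =>
    have hpre : S.Follows S.vMin [b, a, c] [.up, .partialDown, .down] :=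
      .up hb ⟨ha, .down hc .nil⟩
    rcases hρ.hasTailForm_zero with h | h
    · exact ⟨.up_partialDown_down, h.append_left hpre rfl rfl⟩
    · exact ⟨.up_partialDown_down_up, h.append_left hpre rfl rfl⟩
  | @up _ _ c ρ hv hc hρ =>
    have hpre := follows_partialUp_down ha hc
    cases hρ with
    | nil =>
      have htail : S.HasTailForm [b] .up := Follows.hasTailForm (.up hb .nil)
      exact ⟨.partialUp_down_up,
        (htail.append_left hpre rfl rfl).perm (List.reverse_perm [b, a, c])⟩
    | up hv => exact absurd hv (lt_irrefl _)
    | @down _ _ d ρ hv hd hρ =>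
      have hperm : (b :: d :: ([c, a] ++ ρ)).Perm (b :: a :: c :: d :: ρ) :=
        ((List.reverse_perm [a, c, d]).append_right ρ).cons b
      obtain ⟨t, ht⟩ := hρ.exists_hasTailForm_partialUp_down hpre
      exact ⟨t, (ht.leap_cons hb hd).perm hperm⟩

lemma StepPath.exists_hasTailForm (hn : n ≤ 1) (hρ : S.StepPath n S.vMin ρ) :
    ∃ t, S.HasTailForm ρ t := by
  induction hk : ρ.length using Nat.strong_induction_on generalizing ρ with | _ k ih
  cases hρ with
  | nil => exact ⟨.empty, Follows.hasTailForm .nil⟩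
  | down hv => exact absurd hv (lt_irrefl _)
  | partialDown hv ha => exact absurd hv ha.2.1.not_gt
  | @partialUp n _ a ρ hv ha hρ =>
    obtain rfl : n = 0 := by omega
    exact hρ.exists_hasTailForm_of_partialUp ha
  | @up _ _ b ρ hv hb hρ =>
    cases hρ with
    | nil => exact ⟨.up, Follows.hasTailForm (.up hb .nil)⟩
    | up hv => exact absurd hv (lt_irrefl _)
    | partialUp hv ha => exact absurd hv ha.2.2.not_gt
    | down hv hd hρ =>
      obtain ⟨t, ht⟩ := ih _ (by simp [← hk]) hρ rfl
      exact ⟨t, ht.leap_cons hb hd⟩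
    | @partialDown n _ a ρ hv ha hρ =>
      obtain rfl : n = 0 := by omega
      exact hρ.exists_hasTailForm_of_up_partialDown hb ha

variable (S) in
/-- The sequence `σ` can be rearranged into standard form with one of the admissible pairs of
patterns of total length at most five. -/
def HasStandardRearrangement (σ : List (M × ℝ)) : Prop :=
  ∃ σ' h t, (h, t) ∈ patternCombinations ∧ h.steps.length + t.steps.length ≤ 5 ∧
    S.HasForm σ' h t ∧ σ'.Perm σ

variable (S) in
/-- The sequence `σ` never steps down to `vMin` and is short: it consists of at most two timed
actions, or it is a zigzag up, partially down, up that does not start at `vMin`. -/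
def IsShortPath (σ : List (M × ℝ)) : Prop :=
  ∃ p, S.Follows S.v0 σ p ∧ .down ∉ p ∧
    (p.length ≤ 2 ∨ S.vMin < S.v0 ∧ p = [.up, .partialDown, .up])

lemma HasTailForm.hasStandardRearrangement (hρ : S.HasTailForm ρ t)
    (hh : S.Follows S.v0 head h.steps) (hv : h = .empty → S.v0 = S.vMin)
    (hadm : (h, t) ∈ patternCombinations) (hlen : h.steps.length + t.steps.length ≤ 5) :
    S.HasStandardRearrangement (head ++ ρ) := by
  obtain ⟨leaps, tail, hl, ht, hρ⟩ := hρ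
  refine ⟨_, h, t, hadm, hlen, hasForm_of_follows hh hv hl ht, ?_⟩
  rw [List.append_assoc]
  exact hρ.append_left head

lemma HasStandardRearrangement.perm (hσ : S.HasStandardRearrangement ρ) (hp : ρ.Perm ρ') :
    S.HasStandardRearrangement ρ' := by
  obtain ⟨σ, h, t, hadm, hlen, hform, hperm⟩ := hσ
  exact ⟨σ, h, t, hadm, hlen, hform, hperm.trans hp⟩

lemma StepPath.hasStandardRearrangement_append (hρ : S.StepPath 0 S.vMin ρ)
    (hh : S.Follows S.v0 head h.steps) (hne : h ≠ .empty) :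
    S.HasStandardRearrangement (head ++ ρ) := by
  rcases hρ.hasTailForm_zero with ht | ht
  · exact ht.hasStandardRearrangement hh (absurd · hne) (by cases h <;> decide)
      (by cases h <;> decide)
  · exact ht.hasStandardRearrangement hh (absurd · hne) (by cases h <;> decide)
      (by cases h <;> decide)

lemma hasStandardRearrangement_of_eq_vMin (hv : S.v0 = S.vMin) (hn : n ≤ 1)
    (hσ : S.StepPath n S.v0 σ) : S.HasStandardRearrangement σ := by
  obtain ⟨t, ht⟩ := (hv ▸ hσ).exists_hasTailForm hn
  exact ht.hasStandardRearrangement (h := .empty) .nil (fun _ => hv) (by cases t <;> decide)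
    (by cases t <;> decide)

lemma hasStandardRearrangement_of_down (hb : S.IsStep S.v0 b .down) (hn : n ≤ 1)
    (hρ : S.StepPath n S.vMin ρ) : S.HasStandardRearrangement (b :: ρ) := by
  obtain ⟨t, ht⟩ := hρ.exists_hasTailForm hn
  exact ht.hasStandardRearrangement (h := .down) (.down hb .nil) nofun (by cases t <;> decide)
    (by cases t <;> decide)

/-- The tail pattern `up_partialDown_down_up` is too long for the head pattern `up_down`. Swapping
the step down of the head with the middle of the tail turns the first step of the tail into the
beginning of a leap. -/
lemma hasStandardRearrangement_of_up_down (hb : S.IsStep S.v0 b .up)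
    (hd : S.IsStep S.vMax d .down) (hρ : S.HasTailForm ρ t) :
    S.HasStandardRearrangement (b :: d :: ρ) := by
  by_cases ht : t = .up_partialDown_down_up
  · subst ht
    obtain ⟨leaps, tail, hl, ht, hρ⟩ := hρ
    obtain ⟨u, tail, rfl, hu, ht⟩ := follows_cons_right.1 ht
    rw [hu.2] at ht
    obtain ⟨a, tail, rfl, ha, ht⟩ := follows_cons_right.1 ht
    obtain ⟨c, tail, rfl, hc, ht⟩ := follows_cons_right.1 ht
    rw [hc.2] at ht
    have hh : S.Follows S.v0 [b, a, c] [.up, .partialDown, .down] := .up hb ⟨ha, .down hc .nil⟩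
    refine ⟨_, .up_partialDown_down, .up, by decide, by decide,
      hasForm_of_follows hh nofun (hl.leap_cons hu hd) ht, ?_⟩
    classical
    refine List.perm_iff_count.2 fun x => ?_
    have hcount := hρ.count_eq x
    simp only [List.count_append, List.count_cons, List.count_nil] at hcount ⊢
    omega
  · exact hρ.hasStandardRearrangement (h := .up_down) (head := [b, d]) (.up hb (.down hd .nil))
      nofun (by cases t <;> decide) (by cases t <;> first | decide | exact absurd rfl ht)

lemma hasStandardRearrangement_or_isShortPath_of_up_partialDown (hv : S.vMin < S.v0)
    (hb : S.IsStep S.v0 b .up) (ha : S.IsStep S.vMax a .partialDown)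
    (hρ : S.StepPath 0 (S.next S.vMax a) ρ) :
    S.HasStandardRearrangement (b :: a :: ρ) ∨ S.IsShortPath (b :: a :: ρ) := by
  cases hρ with
  | nil => exact .inr ⟨[.up, .partialDown], .up hb ⟨ha, .nil⟩, by decide, .inl le_rfl⟩
  | @down _ _ c ρ _ hc hρ =>
    have hh : S.Follows S.v0 [b, a, c] [.up, .partialDown, .down] := .up hb ⟨ha, .down hc .nil⟩
    exact .inl (hρ.hasStandardRearrangement_append (h := .up_partialDown_down) hh nofun)
  | @up _ _ c ρ _ hc hρ =>
    cases hρ with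
    | nil =>
      have hp : S.Follows S.v0 [b, a, c] [.up, .partialDown, .up] := .up hb ⟨ha, .up hc .nil⟩
      exact .inr ⟨_, hp, by decide, .inr ⟨hv, rfl⟩⟩
    | up hv => exact absurd hv (lt_irrefl _)
    | @down _ _ d ρ _ hd hρ =>
      obtain ⟨t, ht⟩ := hρ.exists_hasTailForm_partialUp_down (follows_partialUp_down ha hc)
      refine .inl ((hasStandardRearrangement_of_up_down hb hd ht).perm ?_)
      exact ((List.reverse_perm [a, c, d]).append_right ρ).cons b

lemma StepPath.follows_or_exists_append (hσ : S.StepPath 0 v σ) :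
    S.Follows v σ [] ∨ S.Follows v σ [.up] ∨ ∃ pre ρ, σ = pre ++ ρ ∧ S.StepPath 0 S.vMin ρ ∧
      (S.Follows v pre [.down] ∨ S.Follows v pre [.up, .down]) := by
  cases hσ with
  | nil => exact .inl .nil
  | @down _ _ a ρ _ ha hρ => exact .inr (.inr ⟨[a], ρ, rfl, hρ, .inl (.down ha .nil)⟩)
  | @up _ _ a ρ _ ha hρ =>
    cases hρ with
    | nil => exact .inr (.inl (.up ha .nil))
    | up hv => exact absurd hv (lt_irrefl _)
    | @down _ _ b ρ _ hb hρ =>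
      exact .inr (.inr ⟨[a, b], ρ, rfl, hρ, .inr (.up ha (.down hb .nil))⟩)

lemma hasStandardRearrangement_or_isShortPath_cons {s : Step}
    (hs : s = .flat ∨ s = .partialUp ∨ s = .partialDown) (ha : S.IsStep S.v0 a s)
    (hσ : S.StepPath 0 (S.next S.v0 a) σ) :
    S.HasStandardRearrangement (a :: σ) ∨ S.IsShortPath (a :: σ) := by
  have hheads : (∃ h : HeadPattern, h ≠ .empty ∧ h.steps = [s, .down]) ∧
      ∃ h : HeadPattern, h ≠ .empty ∧ h.steps = [s, .up, .down] := by
    rcases hs with rfl | rfl | rfl <;> decide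
  obtain ⟨⟨h₁, hne₁, hh₁⟩, h₂, hne₂, hh₂⟩ := hheads
  rcases hσ.follows_or_exists_append with hσ | hσ | ⟨pre, ρ, rfl, hρ, hpre | hpre⟩
  · exact .inr ⟨[s], ⟨ha, hσ⟩, by rcases hs with rfl | rfl | rfl <;> decide, .inl (by simp)⟩
  · exact .inr ⟨[s, .up], ⟨ha, hσ⟩, by rcases hs with rfl | rfl | rfl <;> decide, .inl le_rfl⟩
  · exact .inl (hρ.hasStandardRearrangement_append (head := a :: pre) (hh₁ ▸ ⟨ha, hpre⟩) hne₁)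
  · exact .inl (hρ.hasStandardRearrangement_append (head := a :: pre) (hh₂ ▸ ⟨ha, hpre⟩) hne₂)

lemma StepPath.hasStandardRearrangement_or_isShortPath (hn : n ≤ 1)
    (hσ : S.StepPath n S.v0 σ) : S.HasStandardRearrangement σ ∨ S.IsShortPath σ := by
  rcases S.vMin_le_v0.eq_or_lt with hv | hv
  · exact .inl (hasStandardRearrangement_of_eq_vMin hv.symm hn hσ)
  cases hσ with
  | nil => exact .inr ⟨[], .nil, by decide, .inl (by decide)⟩
  | down _ hb hρ => exact .inl (hasStandardRearrangement_of_down hb hn hρ)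
  | @partialUp n _ a ρ _ ha hρ =>
    obtain rfl : n = 0 := by omega
    exact hasStandardRearrangement_or_isShortPath_cons (.inr (.inl rfl)) ha hρ
  | @partialDown n _ a ρ _ ha hρ =>
    obtain rfl : n = 0 := by omega
    exact hasStandardRearrangement_or_isShortPath_cons (.inr (.inr rfl)) ha hρ
  | @up _ _ b ρ _ hb hρ =>
    cases hρ with
    | nil => exact .inr ⟨[.up], .up hb .nil, by decide, .inl (by decide)⟩
    | up hv => exact absurd hv (lt_irrefl _)
    | partialUp _ ha => exact absurd ‹_› ha.2.2.not_gt
    | @down _ _ d ρ _ hd hρ =>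
      obtain ⟨t, ht⟩ := hρ.exists_hasTailForm hn
      exact .inl (hasStandardRearrangement_of_up_down hb hd ht)
    | @partialDown n _ a ρ _ ha hρ =>
      obtain rfl : n = 0 := by omega
      exact hasStandardRearrangement_or_isShortPath_of_up_partialDown hv hb ha hρ

lemma IsReduced.hasStandardRearrangement_or_isShortPath (hσ : S.IsReduced T σ₀ σ) :
    S.HasStandardRearrangement σ ∨ S.IsShortPath σ := by
  obtain ⟨⟨hpos, -⟩, hsafe⟩ := hσ.prop.1.prop.1
  have hslope := hσ.prop.2
  cases σ with
  | nil => exact .inr ⟨[], .nil, by decide, .inl (by decide)⟩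
  | cons a σ =>
    rw [run, runFrom, List.forall_mem_cons] at hsafe
    rw [List.forall_mem_cons] at hpos
    by_cases ha : S.slope a.1 = 0
    · have hpath := stepPath_innerCount hsafe.2 hpos.2 hslope
      have hcount := hσ.innerCount_tail_eq_zero ha
      rw [← next_of_slope_eq_zero (v := S.v0) ha] at hcount
      exact hasStandardRearrangement_or_isShortPath_cons (.inl rfl) ha (hcount ▸ hpath)
    · exact (stepPath_innerCount (List.forall_mem_cons.2 hsafe) (List.forall_mem_cons.2 hpos)
        (List.forall_mem_cons.2 ⟨ha, hslope⟩)).hasStandardRearrangement_or_isShortPath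
        hσ.innerCount_le_one

lemma IsShortPath.length_le_two_or_follows (hσ : S.IsShortPath σ)
    (hvisit : S.vMin ∈ S.run σ₀ → S.vMin ∈ S.run σ) :
    ((S.v0 = S.vMin ∨ S.vMin ∉ S.run σ₀) ∧ σ.length ≤ 2) ∨
      (S.vMin ∉ S.run σ₀ ∧ S.Follows S.v0 σ [.up, .partialDown, .up]) := by
  obtain ⟨p, hp, hdown, hshort⟩ := hσ
  have hnot (hv : S.vMin < S.v0) : S.vMin ∉ S.run σ₀ :=
    fun hmem => hp.vMin_notMem_runFrom hdown hv (hvisit hmem)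
  rcases hshort with hlen | ⟨hv, rfl⟩
  · exact .inl ⟨S.vMin_le_v0.eq_or_lt.imp Eq.symm hnot, hp.length_eq.trans_le hlen⟩
  · exact .inr ⟨hnot hv, hp⟩

end MultiModeSystem

theorem mainTheorem1_general {M : Type*} (S : MultiModeSystem M) :
    patternCombinations.card = 44 ∧
    ∀ (T : ℝ) (σ : List (M × ℝ)), S.IsSafeSchedule T σ →
      ∃ σ' : List (M × ℝ), S.IsSafeSchedule T σ' ∧ S.cost σ' ≤ S.cost σ ∧
        S.IsAngular σ' ∧ S.ZeroModeOnlyFirst σ' ∧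
        ((∃ h t, (h, t) ∈ patternCombinations ∧ h.steps.length + t.steps.length ≤ 5 ∧
            S.HasForm σ' h t) ∨
          ((S.v0 = S.vMin ∨ S.vMin ∉ S.run σ) ∧ σ'.length ≤ 2) ∨
          (S.vMin ∉ S.run σ ∧ S.Follows S.v0 σ' [.up, .partialDown, .up])) := by
  refine ⟨by decide, fun T σ₀ hσ₀ => ?_⟩
  obtain ⟨σ, hσ⟩ := MultiModeSystem.exists_isReduced hσ₀
  have hshortest := hσ.prop.1
  rcases hσ.hasStandardRearrangement_or_isShortPath with
    ⟨σ', h, t, hadm, hlen, hform, hperm⟩ | hshort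
  · have hshortest' := hform.isShortest_of_perm hshortest hperm
    obtain ⟨hsafe, hcost, -⟩ := hshortest'.prop
    exact ⟨σ', hsafe, hcost, hshortest'.isAngular, hform.zeroModeOnlyFirst,
      .inl ⟨h, t, hadm, hlen, hform⟩⟩
  · obtain ⟨hsafe, hcost, hvisit⟩ := hshortest.prop
    exact ⟨σ, hsafe, hcost, hshortest.isAngular, hσ.prop.2,
      .inr (hshort.length_le_two_or_follows hvisit)⟩

theorem mainTheorem1 {M : Type*} [Finite M] (S : MultiModeSystem M) :
    patternCombinations.card = 44 ∧
    ∀ (T : ℝ) (σ : List (M × ℝ)), S.IsSafeSchedule T σ →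
      ∃ σ' : List (M × ℝ), S.IsSafeSchedule T σ' ∧ S.cost σ' ≤ S.cost σ ∧
        S.IsAngular σ' ∧ S.ZeroModeOnlyFirst σ' ∧
        ((∃ h t, (h, t) ∈ patternCombinations ∧ h.steps.length + t.steps.length ≤ 5 ∧
            S.HasForm σ' h t) ∨
          ((S.v0 = S.vMin ∨ S.vMin ∉ S.run σ) ∧ σ'.length ≤ 2) ∨
          (S.vMin ∉ S.run σ ∧ S.Follows S.v0 σ' [.up, .partialDown, .up])) :=
  mainTheorem1_general S
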